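/- **Quantum SMP model.** In a $k$-party quantum simultaneous message-passing (SMP) protocol, each of $k$ players holds an input string in $\{0,1\}^n$ and sends to a referee one message, a register of qubits whose state (a unit vector) depends only on that player's own input; there is no shared randomness and no shared entanglement. The referee, who does not know the inputs, performs a quantum measurement on all received registers jointly and produces an output. The communication cost is the total number of qubits sent by the players, maximized over the inputs. The protocol is bounded-error for a task if on every input the output is correct with probability at least $2/3$. In the number-in-hand (NIH) network model the input is a simple undirected graph $G=(V,E)$ with $V=\{1,\dots,k\}$, and player $v$ holds the neighborhood vector $\nu_v\in\{0,1\}^k$, where $\nu_v[u]=1$ iff $\{u,v\}\in E$. **Max-$d$-isolated cliques.** A set $S\subseteq V$ is a max-$d$-isolated clique of $G$ if the nodes of $S$ are pairwise adjacent and each node of $S$ has at most $d$ edges to $V\setminus S$ (so the empty set counts as one). **Theorem.** There is a universal constant $C>0$ such that for all integers $k\ge 1$ and $d\ge 1$ there is, in the NIH network model on $k$ nodes, a bounded-error quantum SMP protocol with communication cost at most $C\,k\,d\,\log_2^2 k$ in which the referee outputs the list of all max-$d$-isolated cliques of the input graph. -/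

import Mathlib

open scoped ComplexOrder

/-- A general quantum measurement with outcomes in `O` on the space `ℂ^ι` (a POVM): positive
semidefinite effects, one per outcome, that sum to the identity. -/
structure POVM (ι O : Type) [Fintype ι] [DecidableEq ι] [Fintype O] where
  effect : O → Matrix ι ι ℂ
  posSemidef : ∀ o, (effect o).PosSemidef
  sum_effect : ∑ o, effect o = 1

/-- The probability of outcome `o` when the state `ψ` is measured: `⟨ψ| M_o |ψ⟩`. -/
noncomputable def POVM.prob {ι O : Type} [Fintype ι] [DecidableEq ι] [Fintype O]
    (M : POVM ι O) (ψ : ι → ℂ) (o : O) : ℝ :=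
  (star ψ ⬝ᵥ (M.effect o).mulVec ψ).re

/-- A quantum simultaneous message-passing protocol for `k` players with `n`-bit inputs and a
referee with outputs in `O`. Player `v`, on input `x`, sends a register of `qubits v` qubits in the
state `message v x`, a unit vector whose coordinates are indexed by the computational basis; it
depends only on the player's own input, and there is no shared randomness or entanglement.
The referee measures all the received registers jointly and outputs the outcome. -/
structure QuantumSMP (k n : ℕ) (O : Type) [Fintype O] where
  qubits : Fin k → ℕ
  message : (v : Fin k) → (Fin n → Bool) → EuclideanSpace ℂ (Fin (qubits v) → Bool)
  norm_message : ∀ v x, ‖message v x‖ = 1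
  referee : POVM ((v : Fin k) → Fin (qubits v) → Bool) O

namespace QuantumSMP

variable {k n : ℕ} {O : Type} [Fintype O]

/-- The communication cost: the total number of qubits sent by the players. -/
def cost (P : QuantumSMP k n O) : ℕ := ∑ v, P.qubits v

/-- The state received by the referee: the tensor product of the players' messages. -/
noncomputable def jointState (P : QuantumSMP k n O) (x : Fin k → Fin n → Bool) :
    ((v : Fin k) → Fin (P.qubits v) → Bool) → ℂ :=
  fun b => ∏ v, P.message v (x v) (b v)

/-- The probability that the referee outputs `o` when the players' inputs are `x`. -/
noncomputable def outputProb (P : QuantumSMP k n O) (x : Fin k → Fin n → Bool) (o : O) : ℝ :=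
  P.referee.prob (P.jointState x) o

end QuantumSMP

open Classical in
/-- The neighborhood vector of the node `v`: the characteristic vector of its set of neighbors. -/
noncomputable def neighborhoodVector {k : ℕ} (G : SimpleGraph (Fin k)) (v : Fin k) :
    Fin k → Bool :=
  fun u => decide (G.Adj v u)

/-- In the number-in-hand network model (player `v` holds the neighborhood vector of the node `v`),
the protocol `P` outputs `f G` with probability at least `2/3` on every input graph `G`. -/
def QuantumSMP.SolvesNIH {k : ℕ} {O : Type} [Fintype O] (P : QuantumSMP k k O)
    (f : SimpleGraph (Fin k) → O) : Prop :=
  ∀ G : SimpleGraph (Fin k), 2 / 3 ≤ P.outputProb (neighborhoodVector G) (f G)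

/-- `S` is a max-`d`-isolated clique: it induces a clique, and each of its nodes has at most `d`
edges to nodes outside `S`. -/
def IsMaxIsolatedClique {k : ℕ} (G : SimpleGraph (Fin k)) (d : ℕ) (S : Finset (Fin k)) : Prop :=
  G.IsClique (S : Set (Fin k)) ∧
    ∀ v ∈ S, (G.neighborSet v \ (S : Set (Fin k))).ncard ≤ d

open Classical in
/-- The collection of all max-`d`-isolated cliques of `G`. -/
noncomputable def maxIsolatedCliques {k : ℕ} (d : ℕ) (G : SimpleGraph (Fin k)) :
    Finset (Finset (Fin k)) :=
  Finset.univ.filter fun S => IsMaxIsolatedClique G d S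

/-!
Each player sends a classical string, the degree of her node and the first `4 * d` power sums of its
closed neighborhood over a field `F` of characteristic two, together with `O(log k)` uniform
superpositions of the points `(t, f t)`, where `f` is the polynomial over `F` whose coefficients are
the indicator of the closed neighborhood.

The closed neighborhoods of two nodes of a max-`d`-isolated clique differ in at most `2 * d` places,
so the difference of the power sums determines the difference of the indicators. In general it only
yields a candidate. Translating a graph by the candidate polynomial and comparing it with the other
graph by a swap test tells whether the candidate is correct, since distinct polynomials agree
rarely. A test whose answer is almost certain hardly disturbs the state, so the same copies serve
for all pairs of nodes. A correct difference reveals whether the two nodes are adjacent, and the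
degrees then decide whether a clique is isolated.
-/

section KrausFamilies

open scoped Matrix

variable {ι κ O : Type*} [Fintype ι] [Fintype κ] [Fintype O]

theorem norm_toLp_sq_eq_re_dotProduct (ψ : ι → ℂ) :
    ‖WithLp.toLp 2 ψ‖ ^ 2 = (star ψ ⬝ᵥ ψ).re := by
  rw [@norm_sq_eq_re_inner ℂ, EuclideanSpace.inner_toLp_toLp, dotProduct_comm]
  rfl

theorem norm_toLp_comp_equiv (e : κ ≃ ι) (ψ : ι → ℂ) :
    ‖WithLp.toLp 2 (ψ ∘ e)‖ = ‖WithLp.toLp 2 ψ‖ := by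
  simp only [EuclideanSpace.norm_eq, Function.comp_apply]
  rw [e.sum_comp fun i => ‖ψ i‖ ^ 2]

theorem norm_toLp_mulVec_sq (A : Matrix ι ι ℂ) (ψ : ι → ℂ) :
    ‖WithLp.toLp 2 (A *ᵥ ψ)‖ ^ 2 = (star ψ ⬝ᵥ (Aᴴ * A) *ᵥ ψ).re := by
  rw [norm_toLp_sq_eq_re_dotProduct, Matrix.star_mulVec, ← Matrix.dotProduct_mulVec,
    Matrix.mulVec_mulVec]

theorem conjTranspose_mul_self_of_isStarProjection {P : Matrix ι ι ℂ} (hP : IsStarProjection P) :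
    Pᴴ * P = P := by
  rw [← Matrix.star_eq_conjTranspose, hP.isSelfAdjoint.star_eq, hP.isIdempotentElem.eq]

variable [DecidableEq ι]

/-- A family of Kraus operators: the operator `E o` describes what a measurement does to the state
when its outcome is `o`. -/
def IsKrausFamily (E : O → Matrix ι ι ℂ) : Prop :=
  ∑ o, (E o)ᴴ * E o = 1

theorem IsKrausFamily.sum_norm_mulVec_sq {E : O → Matrix ι ι ℂ} (hE : IsKrausFamily E)
    (ψ : ι → ℂ) : ∑ o, ‖WithLp.toLp 2 (E o *ᵥ ψ)‖ ^ 2 = ‖WithLp.toLp 2 ψ‖ ^ 2 := by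
  simp only [norm_toLp_mulVec_sq, ← Complex.re_sum, ← dotProduct_sum, ← Matrix.sum_mulVec]
  rw [hE, Matrix.one_mulVec, norm_toLp_sq_eq_re_dotProduct]

theorem IsKrausFamily.norm_mulVec_le {E : O → Matrix ι ι ℂ} (hE : IsKrausFamily E) (o : O)
    (ψ : ι → ℂ) : ‖WithLp.toLp 2 (E o *ᵥ ψ)‖ ≤ ‖WithLp.toLp 2 ψ‖ := by
  refine pow_le_pow_iff_left₀ (norm_nonneg _) (norm_nonneg _) two_ne_zero |>.1 ?_
  rw [← hE.sum_norm_mulVec_sq ψ]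
  exact Finset.single_le_sum (fun o _ => sq_nonneg ‖WithLp.toLp 2 (E o *ᵥ ψ)‖)
    (Finset.mem_univ o)

/-- The Kraus operators of the measurements `E 0, E 1, …, E (N - 1)` performed one after the other,
the last one first. -/
def sequentialKraus : {N : ℕ} → (Fin N → O → Matrix ι ι ℂ) → (Fin N → O) → Matrix ι ι ℂ
  | 0, _, _ => 1
  | _ + 1, E, o => E 0 (o 0) * sequentialKraus (Fin.tail E) (Fin.tail o)

theorem isKrausFamily_sequentialKraus {N : ℕ} {E : Fin N → O → Matrix ι ι ℂ}
    (hE : ∀ i, IsKrausFamily (E i)) : IsKrausFamily (sequentialKraus E) := by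
  induction N with
  | zero => simp [IsKrausFamily, sequentialKraus]
  | succ N ih =>
    let K := sequentialKraus (Fin.tail E)
    calc ∑ o, (sequentialKraus E o)ᴴ * sequentialKraus E o
        = ∑ o, ∑ a, (K o)ᴴ * ((E 0 a)ᴴ * E 0 a) * K o := by
          rw [← (Fin.consEquiv fun _ => O).sum_comp, Fintype.sum_prod_type, Finset.sum_comm]
          refine Finset.sum_congr rfl fun o _ => Finset.sum_congr rfl fun a _ => ?_
          simp [sequentialKraus, K, Fin.consEquiv, Matrix.mul_assoc]
      _ = ∑ o, (K o)ᴴ * K o := by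
          have gram : ∑ a, (E 0 a)ᴴ * E 0 a = 1 := hE 0
          simp only [← Matrix.sum_mul, ← Matrix.mul_sum, gram, Matrix.mul_one]
      _ = 1 := ih fun i => hE i.succ

theorem norm_sequentialKraus_mulVec_sub_le {N : ℕ} {E : Fin N → O → Matrix ι ι ℂ}
    (hE : ∀ i, IsKrausFamily (E i)) (o : Fin N → O) (ψ : ι → ℂ) :
    ‖WithLp.toLp 2 (sequentialKraus E o *ᵥ ψ - ψ)‖ ≤
      ∑ i, ‖WithLp.toLp 2 (E i (o i) *ᵥ ψ - ψ)‖ := by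
  induction N with
  | zero => simp [sequentialKraus]
  | succ N ih =>
    set φ := sequentialKraus (Fin.tail E) (Fin.tail o) *ᵥ ψ
    have split : sequentialKraus E o *ᵥ ψ - ψ =
        (E 0 (o 0) *ᵥ ψ - ψ) + E 0 (o 0) *ᵥ (φ - ψ) := by
      rw [Matrix.mulVec_sub, Matrix.mulVec_mulVec, sequentialKraus]
      abel
    rw [split, WithLp.toLp_add, Fin.sum_univ_succ]
    refine (norm_add_le _ _).trans (add_le_add_right ?_ _)
    exact ((hE 0).norm_mulVec_le _ _).trans (ih (fun i => hE i.succ) (Fin.tail o))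

/-- The Kraus operators of the two-outcome test of membership in the range of the projection `P`. -/
def binaryTest (P : Matrix ι ι ℂ) : Bool → Matrix ι ι ℂ
  | true => P
  | false => 1 - P

theorem isKrausFamily_binaryTest {P : Matrix ι ι ℂ} (hP : IsStarProjection P) :
    IsKrausFamily (binaryTest P) := by
  simp only [IsKrausFamily, Fintype.sum_bool, binaryTest, add_sub_cancel,
    conjTranspose_mul_self_of_isStarProjection hP,
    conjTranspose_mul_self_of_isStarProjection hP.one_sub]

end KrausFamilies

namespace POVM

open scoped Matrix

variable {ι κ O O' : Type} [Fintype ι] [DecidableEq ι] [Fintype κ] [DecidableEq κ] [Fintype O]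
  [Fintype O']

/-- The measurement with Kraus operators `E`, without the resulting state. -/
def ofKraus (E : O → Matrix ι ι ℂ) (hE : IsKrausFamily E) : POVM ι O where
  effect o := (E o)ᴴ * E o
  posSemidef _ := Matrix.posSemidef_conjTranspose_mul_self _
  sum_effect := hE

theorem prob_ofKraus {E : O → Matrix ι ι ℂ} (hE : IsKrausFamily E) (ψ : ι → ℂ) (o : O) :
    (ofKraus E hE).prob ψ o = ‖WithLp.toLp 2 (E o *ᵥ ψ)‖ ^ 2 :=
  (norm_toLp_mulVec_sq _ _).symm

/-- The measurements with Kraus operators `E i`, performed one after the other. -/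
def sequential {N : ℕ} (E : Fin N → O → Matrix ι ι ℂ) (hE : ∀ i, IsKrausFamily (E i)) :
    POVM ι (Fin N → O) :=
  ofKraus (sequentialKraus E) (isKrausFamily_sequentialKraus hE)

/-- A union bound for measurements that need not commute: the disturbances of the state add up. -/
theorem le_prob_sequential {N : ℕ} {E : Fin N → O → Matrix ι ι ℂ} (hE : ∀ i, IsKrausFamily (E i))
    (o : Fin N → O) {ψ : ι → ℂ} (hψ : ‖WithLp.toLp 2 ψ‖ = 1) {ε : ℝ} (hε : ε ≤ 1)
    (hsum : ∑ i, ‖WithLp.toLp 2 (E i (o i) *ᵥ ψ - ψ)‖ ≤ ε) :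
    (1 - ε) ^ 2 ≤ (sequential E hE).prob ψ o := by
  have near := (norm_sequentialKraus_mulVec_sub_le hE o ψ).trans hsum
  have reverse_triangle := norm_sub_norm_le (WithLp.toLp 2 ψ)
    (WithLp.toLp 2 (sequentialKraus E o *ᵥ ψ))
  rw [norm_sub_rev, ← WithLp.toLp_sub, hψ] at reverse_triangle
  rw [sequential, prob_ofKraus]
  exact pow_le_pow_left₀ (by linarith) (by linarith) 2

theorem prob_nonneg (M : POVM ι O) (ψ : ι → ℂ) (o : O) : 0 ≤ M.prob ψ o :=
  (Complex.le_def.1 ((M.posSemidef o).dotProduct_mulVec_nonneg ψ)).1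

/-- Classical post-processing of the outcome of a measurement. -/
def map [DecidableEq O'] (M : POVM ι O) (g : O → O') : POVM ι O' where
  effect o' := ∑ o with g o = o', M.effect o
  posSemidef _ := Matrix.posSemidef_sum _ fun o _ => M.posSemidef o
  sum_effect := (Finset.sum_fiberwise _ _ _).trans M.sum_effect

theorem prob_le_prob_map [DecidableEq O'] (M : POVM ι O) (g : O → O') (ψ : ι → ℂ) (o : O) :
    M.prob ψ o ≤ (M.map g).prob ψ (g o) := by
  have sum_fiber : (M.map g).prob ψ (g o) = ∑ i with g i = g o, M.prob ψ i := by
    simp only [prob, map, Matrix.sum_mulVec, dotProduct_sum, Complex.re_sum]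
  rw [sum_fiber]
  exact Finset.single_le_sum (fun i _ => M.prob_nonneg ψ i) (by simp)

/-- Relabelling of the computational basis. -/
def reindex (M : POVM ι O) (e : κ ≃ ι) : POVM κ O where
  effect o := (M.effect o).submatrix e e
  posSemidef o := (M.posSemidef o).submatrix e
  sum_effect := by
    rw [← Matrix.submatrix_one_equiv e, ← M.sum_effect]
    ext
    simp only [Matrix.sum_apply, Matrix.submatrix_apply]

theorem prob_reindex (M : POVM ι O) (e : κ ≃ ι) (ψ : ι → ℂ) (o : O) :
    (M.reindex e).prob (ψ ∘ e) o = M.prob ψ o := by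
  simp only [prob, reindex, Matrix.submatrix_mulVec_equiv, Function.comp_assoc,
    Equiv.self_comp_symm, Function.comp_id]
  exact congrArg Complex.re (e.sum_comp fun i => star (ψ i) * (M.effect o *ᵥ ψ) i)

/-- The measurement that reads the classical register `κ` and then measures the register `ι` in a
way that depends on the value read. -/
def controlled (M : κ → POVM ι O) : POVM (ι × κ) O where
  effect o := Matrix.blockDiagonal fun c => (M c).effect o
  posSemidef o := by
    have root (c : κ) : ∃ B, (M c).effect o = Bᴴ * B := by
      open scoped MatrixOrder in
      exact CStarAlgebra.nonneg_iff_eq_star_mul_self.1 ((M c).posSemidef o).nonneg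
    choose B hB using root
    simp only [hB, Matrix.blockDiagonal_mul]
    rw [← Matrix.blockDiagonal_conjTranspose]
    exact Matrix.posSemidef_conjTranspose_mul_self _
  sum_effect := by
    have blocks : ∑ o, (fun c => (M c).effect o) = 1 := by
      ext1 c
      exact (Finset.sum_apply _ _ _).trans (M c).sum_effect
    rw [← Matrix.blockDiagonal_one, ← blocks]
    exact (map_sum (Matrix.blockDiagonalAddMonoidHom ι ι κ ℂ)
      (fun o c => (M c).effect o) Finset.univ).symm

theorem prob_controlled (M : κ → POVM ι O) (c : κ) (ψ : ι → ℂ) (o : O) :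
    (controlled M).prob (fun a => if a.2 = c then ψ a.1 else 0) o = (M c).prob ψ o := by
  simp [prob, controlled, dotProduct, Matrix.mulVec, Fintype.sum_prod_type,
    Matrix.blockDiagonal_apply]

/-- The measurement whose outcome is always `o`. -/
def const [DecidableEq O] (o : O) : POVM ι O where
  effect o' := if o' = o then 1 else 0
  posSemidef o' := by
    split
    · exact Matrix.PosSemidef.one
    · exact Matrix.PosSemidef.zero
  sum_effect := by simp

theorem prob_const [DecidableEq O] (o : O) (ψ : ι → ℂ) :
    (const o).prob ψ o = ‖WithLp.toLp 2 ψ‖ ^ 2 := by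
  simp [prob, const, norm_toLp_sq_eq_re_dotProduct]

end POVM

section TensorProducts

open scoped Matrix

variable {I : Type*} [Fintype I] {B : I → Type*}

/-- The tensor product of the vectors `φ i`. -/
def tensorVec (φ : (i : I) → B i → ℂ) : ((i : I) → B i) → ℂ :=
  fun b => ∏ i, φ i (b i)

/-- The tensor product of the operators `P i`. -/
def tensorMatrix (P : (i : I) → Matrix (B i) (B i) ℂ) :
    Matrix ((i : I) → B i) ((i : I) → B i) ℂ :=
  Matrix.of fun b b' => ∏ i, P i (b i) (b' i)

theorem conjTranspose_tensorMatrix (P : (i : I) → Matrix (B i) (B i) ℂ) :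
    (tensorMatrix P)ᴴ = tensorMatrix fun i => (P i)ᴴ := by
  ext b b'
  exact star_prod _ _

variable [DecidableEq I] [∀ i, Fintype (B i)]

theorem tensorMatrix_mul (P Q : (i : I) → Matrix (B i) (B i) ℂ) :
    tensorMatrix P * tensorMatrix Q = tensorMatrix fun i => P i * Q i := by
  ext b b'
  simp only [tensorMatrix, Matrix.mul_apply, Matrix.of_apply, ← Finset.prod_mul_distrib,
    Finset.prod_univ_sum, Fintype.piFinset_univ]

theorem tensorMatrix_mulVec_tensorVec (P : (i : I) → Matrix (B i) (B i) ℂ)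
    (φ : (i : I) → B i → ℂ) :
    tensorMatrix P *ᵥ tensorVec φ = tensorVec fun i => P i *ᵥ φ i := by
  ext b
  simp only [tensorMatrix, tensorVec, Matrix.mulVec, dotProduct, Matrix.of_apply,
    ← Finset.prod_mul_distrib, Finset.prod_univ_sum, Fintype.piFinset_univ]

theorem star_tensorVec_dotProduct_tensorVec (φ χ : (i : I) → B i → ℂ) :
    star (tensorVec φ) ⬝ᵥ tensorVec χ = ∏ i, star (φ i) ⬝ᵥ χ i := by
  simp only [tensorVec, dotProduct, Pi.star_apply, star_prod, ← Finset.prod_mul_distrib,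
    Finset.prod_univ_sum, Fintype.piFinset_univ]

theorem isStarProjection_tensorMatrix {P : (i : I) → Matrix (B i) (B i) ℂ}
    (hP : ∀ i, IsStarProjection (P i)) : IsStarProjection (tensorMatrix P) where
  isIdempotentElem := by
    simp only [IsIdempotentElem, tensorMatrix_mul, (hP _).isIdempotentElem.eq]
  isSelfAdjoint := by
    rw [IsSelfAdjoint, Matrix.star_eq_conjTranspose, conjTranspose_tensorMatrix]
    exact congrArg tensorMatrix (funext fun i => (hP i).isSelfAdjoint.star_eq)

end TensorProducts

section UniformStates

open scoped Matrix

variable {B B' : Type*} [DecidableEq B]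

/-- The uniform superposition of the basis vectors in `A`; it is `0` if `A` is empty. -/
noncomputable def uniformState (A : Finset B) : B → ℂ :=
  fun b => if b ∈ A then ((√(A.card : ℝ))⁻¹ : ℝ) else 0

theorem uniformState_comp_equiv [DecidableEq B'] (e : B' ≃ B) {A' : Finset B'} {A : Finset B}
    (h : ∀ b, e b ∈ A ↔ b ∈ A') : uniformState A ∘ e = uniformState A' := by
  have card_eq : A'.card = A.card :=
    Finset.card_bijective e e.bijective fun b => (h b).symm
  ext b
  simp [uniformState, h, card_eq]

theorem tensorVec_uniformState {I : Type*} [Fintype I] [DecidableEq I] {B : I → Type*}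
    [∀ i, DecidableEq (B i)] (A : (i : I) → Finset (B i)) :
    (tensorVec fun i => uniformState (A i)) = uniformState (Fintype.piFinset A) := by
  ext b
  have amplitude : √(((Fintype.piFinset A).card : ℕ) : ℝ) = ∏ i, √((A i).card : ℝ) := by
    rw [Fintype.card_piFinset, Nat.cast_prod, Real.sqrt_prod _ fun i _ => Nat.cast_nonneg _]
  simp only [tensorVec, uniformState, Fintype.prod_ite_zero, Fintype.mem_piFinset, amplitude,
    Complex.ofReal_inv, Complex.ofReal_prod, Finset.prod_inv_distrib]

variable [Fintype B]

theorem star_uniformState_dotProduct_comp (A : Finset B) (σ : B → B) :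
    star (uniformState A) ⬝ᵥ (uniformState A ∘ σ) = ({b ∈ A | σ b ∈ A}.card / A.card : ℝ) := by
  have amplitude_sq : (√(A.card : ℝ))⁻¹ * (√(A.card : ℝ))⁻¹ = (A.card : ℝ)⁻¹ := by
    rw [← mul_inv, Real.mul_self_sqrt (Nat.cast_nonneg _)]
  have term (b : B) : star (uniformState A b) * uniformState A (σ b) =
      if b ∈ A ∧ σ b ∈ A then (((A.card : ℝ)⁻¹ : ℝ) : ℂ) else 0 := by
    rw [← amplitude_sq]
    by_cases hb : b ∈ A <;> by_cases hσ : σ b ∈ A <;> simp [uniformState, hb, hσ]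
  simp only [dotProduct, Pi.star_apply, Function.comp_apply, term, ← Finset.sum_filter,
    Finset.sum_const, Finset.filter_and, Finset.filter_univ_mem, Finset.inter_filter,
    Finset.inter_univ]
  rw [nsmul_eq_mul, div_eq_mul_inv, Complex.ofReal_mul, Complex.ofReal_natCast]

theorem star_uniformState_dotProduct_self (A : Finset B) :
    star (uniformState A) ⬝ᵥ uniformState A = (A.card / A.card : ℝ) := by
  simpa using star_uniformState_dotProduct_comp A id

theorem norm_toLp_uniformState {A : Finset B} (hA : A.Nonempty) :
    ‖WithLp.toLp 2 (uniformState A)‖ = 1 := by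
  have card_ne_zero : (A.card : ℝ) ≠ 0 := Nat.cast_ne_zero.2 hA.card_ne_zero
  rw [← pow_left_inj₀ (norm_nonneg _) zero_le_one two_ne_zero, norm_toLp_sq_eq_re_dotProduct,
    star_uniformState_dotProduct_self, div_self card_ne_zero, Complex.ofReal_re, one_pow]

end UniformStates

section Symmetrizers

open scoped Matrix

variable {B : Type*} [Fintype B] [DecidableEq B]

/-- For an involution `σ` of the basis, the projection onto the vectors invariant under `σ`. -/
noncomputable def symmetrizer (σ : Equiv.Perm B) : Matrix B B ℂ :=
  (1 / 2 : ℂ) • (1 + σ.permMatrix ℂ)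

theorem isStarProjection_symmetrizer {σ : Equiv.Perm B} (hσ : σ * σ = 1) :
    IsStarProjection (symmetrizer σ) where
  isIdempotentElem := by
    have square : σ.permMatrix ℂ * σ.permMatrix ℂ = 1 := by
      rw [← Matrix.permMatrix_mul, hσ, Matrix.permMatrix_one]
    rw [IsIdempotentElem, symmetrizer, smul_mul_smul_comm, add_mul, one_mul, mul_add, mul_one,
      square]
    module
  isSelfAdjoint := by
    rw [IsSelfAdjoint, Matrix.star_eq_conjTranspose, symmetrizer, Matrix.conjTranspose_smul,
      Matrix.conjTranspose_add, Matrix.conjTranspose_one, Matrix.conjTranspose_permMatrix,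
      inv_eq_of_mul_eq_one_left hσ]
    simp

theorem symmetrizer_mulVec (σ : Equiv.Perm B) (φ : B → ℂ) :
    symmetrizer σ *ᵥ φ = (1 / 2 : ℂ) • (φ + φ ∘ σ) := by
  rw [symmetrizer, Matrix.smul_mulVec, Matrix.add_mulVec, Matrix.one_mulVec,
    Matrix.permMatrix_mulVec]

theorem symmetrizer_mulVec_uniformState {σ : Equiv.Perm B} {A : Finset B}
    (h : ∀ b, σ b ∈ A ↔ b ∈ A) : symmetrizer σ *ᵥ uniformState A = uniformState A := by
  rw [symmetrizer_mulVec, uniformState_comp_equiv σ h]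
  module

theorem star_uniformState_dotProduct_symmetrizer (σ : Equiv.Perm B) (A : Finset B) :
    star (uniformState A) ⬝ᵥ symmetrizer σ *ᵥ uniformState A =
      ((A.card / A.card + {b ∈ A | σ b ∈ A}.card / A.card) / 2 : ℝ) := by
  rw [symmetrizer_mulVec, dotProduct_smul, dotProduct_add, star_uniformState_dotProduct_self,
    star_uniformState_dotProduct_comp]
  push_cast
  rw [smul_eq_mul]
  ring

theorem norm_tensorMatrix_symmetrizer_mulVec_le (L : ℕ) {σ : Equiv.Perm B} (hσ : σ * σ = 1)
    {A : Finset B} (h : 2 * {b ∈ A | σ b ∈ A}.card ≤ A.card) :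
    ‖WithLp.toLp 2 ((tensorMatrix fun _ : Fin L => symmetrizer σ) *ᵥ
      tensorVec fun _ => uniformState A)‖ ≤ √((3 / 4) ^ L) := by
  refine Real.le_sqrt_of_sq_le ?_
  rw [norm_toLp_mulVec_sq, conjTranspose_mul_self_of_isStarProjection
      (isStarProjection_tensorMatrix fun _ => isStarProjection_symmetrizer hσ),
    tensorMatrix_mulVec_tensorVec, star_tensorVec_dotProduct_tensorVec]
  simp only [star_uniformState_dotProduct_symmetrizer, Finset.prod_const, Finset.card_univ,
    Fintype.card_fin]
  rw [← Complex.ofReal_pow, Complex.ofReal_re]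
  have overlap : ({b ∈ A | σ b ∈ A}.card : ℝ) / A.card ≤ 1 / 2 := by
    refine div_le_of_le_mul₀ (Nat.cast_nonneg _) (by norm_num) ?_
    have : (2 : ℝ) * {b ∈ A | σ b ∈ A}.card ≤ A.card := by exact_mod_cast h
    linarith
  have self_overlap := div_self_le_one (A.card : ℝ)
  exact pow_le_pow_left₀ (by positivity) (by linarith) L

end Symmetrizers

section TwistedSwaps

variable {V X : Type*} [DecidableEq V]

/-- The involution of `V → X` that exchanges the coordinates `u` and `v`, up to a relabelling by
`e` on the way from `v` to `u`. -/
def twistedSwap (u v : V) (e : Equiv.Perm X) : Equiv.Perm (V → X) :=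
  let relabel : Equiv.Perm (V → X) := Equiv.piCongrRight (Pi.mulSingle u e)
  relabel * (Equiv.swap u v).arrowCongr (Equiv.refl X) * relabel⁻¹

theorem twistedSwap_mul_self (u v : V) (e : Equiv.Perm X) :
    twistedSwap u v e * twistedSwap u v e = 1 := by
  ext b
  simp [twistedSwap]

theorem twistedSwap_apply {u v : V} (huv : u ≠ v) (e : Equiv.Perm X) (b : V → X) :
    twistedSwap u v e b = Function.update (Function.update b u (e (b v))) v (e.symm (b u)) := by
  ext w
  rcases eq_or_ne w v with rfl | hv
  · simp [twistedSwap, huv.symm]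
  rcases eq_or_ne w u with rfl | hu
  · simp [twistedSwap, hv, Equiv.Perm.one_def]
  · simp [twistedSwap, hu, hv, Equiv.swap_apply_of_ne_of_ne]

variable [Fintype V]

theorem twistedSwap_mem_piFinset_iff {u v : V} (huv : u ≠ v) {e : Equiv.Perm X}
    {A : V → Finset X} (h : ∀ x, e x ∈ A u ↔ x ∈ A v) (b : V → X) :
    twistedSwap u v e b ∈ Fintype.piFinset A ↔ b ∈ Fintype.piFinset A := by
  have of_mem {b : V → X} (hb : b ∈ Fintype.piFinset A) :
      twistedSwap u v e b ∈ Fintype.piFinset A := by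
    rw [Fintype.mem_piFinset] at hb ⊢
    intro w
    rw [twistedSwap_apply huv]
    rcases eq_or_ne w v with rfl | hv
    · simp [← h, hb]
    rcases eq_or_ne w u with rfl | hu <;> simp [*]
  refine ⟨fun hb => ?_, of_mem⟩
  simpa only [← Equiv.Perm.mul_apply, twistedSwap_mul_self, Equiv.Perm.one_apply] using of_mem hb

variable [DecidableEq X] in
theorem two_mul_card_twistedSwap_mem_piFinset_le {u v : V} (huv : u ≠ v) {e : Equiv.Perm X}
    {A : V → Finset X} (h : 2 * {x ∈ A v | e x ∈ A u}.card ≤ (A v).card) :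
    2 * {b ∈ Fintype.piFinset A | twistedSwap u v e b ∈ Fintype.piFinset A}.card ≤
      (Fintype.piFinset A).card := by
  set T := {x ∈ A v | e x ∈ A u}
  have subset : {b ∈ Fintype.piFinset A | twistedSwap u v e b ∈ Fintype.piFinset A} ⊆
      Fintype.piFinset (Function.update A v T) := by
    rw [Fintype.piFinset_update_eq_filter_piFinset_mem A v (Finset.filter_subset _ _)]
    refine Finset.monotone_filter_right _ fun b hb hσ => ?_
    have hu := Fintype.mem_piFinset.1 hσ u
    rw [twistedSwap_apply huv, Function.update_of_ne huv, Function.update_self] at hu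
    exact Finset.mem_filter.2 ⟨Fintype.mem_piFinset.1 hb v, hu⟩
  calc 2 * {b ∈ Fintype.piFinset A | twistedSwap u v e b ∈ Fintype.piFinset A}.card
      ≤ 2 * (Fintype.piFinset (Function.update A v T)).card := by
        gcongr
    _ = 2 * T.card * ∏ w ∈ Finset.univ \ {v}, (A w).card := by
        simp only [Fintype.card_piFinset, Function.apply_update fun _ => Finset.card,
          Finset.prod_update_of_mem (Finset.mem_univ v), mul_assoc]
    _ ≤ (A v).card * ∏ w ∈ Finset.univ \ {v}, (A w).card := by
        gcongr
    _ = (Fintype.piFinset A).card := by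
        rw [Fintype.card_piFinset,
          Finset.prod_eq_mul_prod_sdiff_singleton_of_mem (Finset.mem_univ v)]

end TwistedSwaps

section SwapTests

open scoped Matrix

variable {V X : Type*} [Fintype V] [DecidableEq V] [Fintype X] [DecidableEq X]

/-- The product of `L` swap tests of the registers of `u` and `v`, up to a relabelling by `e`, on
`L` copies of a joint state of registers indexed by `V`. -/
noncomputable def swapTest (L : ℕ) (u v : V) (e : Equiv.Perm X) :
    Matrix (Fin L → V → X) (Fin L → V → X) ℂ :=
  tensorMatrix fun _ => symmetrizer (twistedSwap u v e)

theorem isStarProjection_swapTest (L : ℕ) (u v : V) (e : Equiv.Perm X) :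
    IsStarProjection (swapTest L u v e) :=
  isStarProjection_tensorMatrix fun _ => isStarProjection_symmetrizer (twistedSwap_mul_self u v e)

/-- `L` copies of the uniform superpositions of the sets `A v`. -/
noncomputable def fingerprintState (L : ℕ) (A : V → Finset X) : (Fin L → V → X) → ℂ :=
  tensorVec fun _ => uniformState (Fintype.piFinset A)

theorem norm_toLp_fingerprintState (L : ℕ) {A : V → Finset X} (hA : ∀ v, (A v).Nonempty) :
    ‖WithLp.toLp 2 (fingerprintState L A)‖ = 1 := by
  rw [fingerprintState, tensorVec_uniformState]
  exact norm_toLp_uniformState <|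
    Fintype.piFinset_nonempty.2 fun _ => Fintype.piFinset_nonempty.2 hA

/-- The possible results of a swap test between two sets, up to a relabelling by `e`: either `e`
maps `A` onto `A'`, or it maps at least half of `A` outside `A'`. -/
def SwapPromise (e : Equiv.Perm X) (A A' : Finset X) : Bool → Prop
  | true => ∀ x, e x ∈ A' ↔ x ∈ A
  | false => 2 * {x ∈ A | e x ∈ A'}.card ≤ A.card

theorem norm_binaryTest_swapTest_sub_le (L : ℕ) {u v : V} (huv : u ≠ v) {e : Equiv.Perm X}
    {A : V → Finset X} {b : Bool} (h : SwapPromise e (A v) (A u) b) :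
    ‖WithLp.toLp 2 (binaryTest (swapTest L u v e) b *ᵥ fingerprintState L A -
      fingerprintState L A)‖ ≤ √((3 / 4) ^ L) := by
  cases b with
  | true =>
    have invariant : swapTest L u v e *ᵥ fingerprintState L A = fingerprintState L A := by
      rw [swapTest, fingerprintState, tensorMatrix_mulVec_tensorVec,
        symmetrizer_mulVec_uniformState (twistedSwap_mem_piFinset_iff huv h)]
    simp [binaryTest, invariant]
  | false =>
    have residual : (1 - swapTest L u v e) *ᵥ fingerprintState L A - fingerprintState L A =
        -(swapTest L u v e *ᵥ fingerprintState L A) := by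
      rw [Matrix.sub_mulVec, Matrix.one_mulVec, sub_sub_cancel_left]
    rw [binaryTest, residual, WithLp.toLp_neg, norm_neg]
    exact norm_tensorMatrix_symmetrizer_mulVec_le L (twistedSwap_mul_self u v e)
      (two_mul_card_twistedSwap_mem_piFinset_le huv h)

end SwapTests

section SwapTestMeasurement

variable {V X : Type} [Fintype V] [DecidableEq V] [Fintype X] [DecidableEq X]

/-- The swap tests of the registers of `u i` and `v i`, up to a relabelling by `e i`, performed one
after the other. -/
noncomputable def POVM.swapTests (L : ℕ) {N : ℕ} (u v : Fin N → V) (e : Fin N → Equiv.Perm X) :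
    POVM (Fin L → V → X) (Fin N → Bool) :=
  POVM.sequential (fun i => binaryTest (swapTest L (u i) (v i) (e i)))
    fun i => isKrausFamily_binaryTest (isStarProjection_swapTest L (u i) (v i) (e i))

theorem POVM.two_thirds_le_prob_swapTests {L N : ℕ} (hL : 64 * (N : ℝ) ^ 2 * (3 / 4) ^ L ≤ 1)
    {u v : Fin N → V} (huv : ∀ i, u i ≠ v i) {e : Fin N → Equiv.Perm X} {A : V → Finset X}
    (hA : ∀ v, (A v).Nonempty) {b : Fin N → Bool}
    (h : ∀ i, SwapPromise (e i) (A (v i)) (A (u i)) (b i)) :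
    2 / 3 ≤ (POVM.swapTests L u v e).prob (fingerprintState L A) b := by
  have total : ∑ _ : Fin N, √((3 / 4 : ℝ) ^ L) ≤ 1 / 8 := by
    rw [Finset.sum_const, Finset.card_univ, Fintype.card_fin, nsmul_eq_mul]
    refine (pow_le_pow_iff_left₀ (by positivity) (by norm_num) two_ne_zero).1 ?_
    rw [mul_pow, Real.sq_sqrt (by positivity)]
    linarith
  calc (2 / 3 : ℝ) ≤ (1 - 1 / 8) ^ 2 := by norm_num
    _ ≤ _ := POVM.le_prob_sequential _ b (norm_toLp_fingerprintState L hA) (by norm_num) <|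
        (Finset.sum_le_sum fun i _ => norm_binaryTest_swapTest_sub_le L (huv i) (h i)).trans total

end SwapTestMeasurement

section FunctionGraphs

variable {T W : Type*}

/-- The parametrization `t ↦ (t, f t)` of the graph of `f`. -/
@[simps]
def graphEmbedding (f : T → W) : T ↪ T × W where
  toFun t := (t, f t)
  inj' _ _ h := congrArg Prod.fst h

variable [Fintype T]

/-- The graph of `f`, as a set of pairs. -/
def functionGraph (f : T → W) : Finset (T × W) :=
  Finset.univ.map (graphEmbedding f)

theorem mem_functionGraph {f : T → W} {a : T × W} : a ∈ functionGraph f ↔ a.2 = f a.1 := by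
  simp [functionGraph, Prod.ext_iff, eq_comm]

theorem card_functionGraph (f : T → W) : (functionGraph f).card = Fintype.card T :=
  Finset.card_map _

theorem functionGraph_nonempty [Nonempty T] (f : T → W) : (functionGraph f).Nonempty :=
  Finset.univ_nonempty.map

/-- The permutation `(t, y) ↦ (t, y + p t)`, which translates function graphs by `p`. -/
def shear [AddGroup W] (p : T → W) : Equiv.Perm (T × W) :=
  Equiv.prodShear (Equiv.refl T) fun t => Equiv.addRight (p t)

variable [AddGroup W]

theorem shear_mem_functionGraph {p f : T → W} {a : T × W} :
    shear p a ∈ functionGraph f ↔ a.2 + p a.1 = f a.1 := by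
  simp [mem_functionGraph, shear]

variable [DecidableEq T] [DecidableEq W]

theorem swapPromise_shear_true {p f g : T → W} (h : f + p = g) :
    SwapPromise (shear p) (functionGraph f) (functionGraph g) true := by
  intro a
  rw [shear_mem_functionGraph, mem_functionGraph, ← h, Pi.add_apply, add_left_inj]

theorem swapPromise_shear_false {p f g : T → W}
    (h : 2 * ({t | f t + p t = g t} : Finset T).card ≤ Fintype.card T) :
    SwapPromise (shear p) (functionGraph f) (functionGraph g) false := by
  have agreement : {a ∈ functionGraph f | shear p a ∈ functionGraph g} =
      ({t | f t + p t = g t} : Finset T).map (graphEmbedding f) := by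
    ext ⟨t, y⟩
    rw [Finset.mem_filter, shear_mem_functionGraph, mem_functionGraph, Finset.mem_map]
    aesop
  rwa [SwapPromise, agreement, Finset.card_map, card_functionGraph]

end FunctionGraphs

section PolynomialGraphs

variable {F : Type*} [Field F] [DecidableEq F] {k : ℕ}

/-- The polynomial function with coefficient vector `D`. -/
noncomputable def polynomialFunction (D : Fin k → F) : F → F :=
  fun t => (Polynomial.ofFn k D).eval t

theorem polynomialFunction_add (D D' : Fin k → F) :
    polynomialFunction (D + D') = polynomialFunction D + polynomialFunction D' := by
  ext t
  simp [polynomialFunction]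

variable [Fintype F]

theorem card_polynomialFunction_eq_le {D D' : Fin k → F} (h : D ≠ D') :
    ({t | polynomialFunction D t = polynomialFunction D' t} : Finset F).card ≤ k := by
  have ne_zero : Polynomial.ofFn k (D - D') ≠ 0 := by
    rw [map_sub]
    exact sub_ne_zero.2 ((Polynomial.injective_ofFn k).ne h)
  refine (Polynomial.card_le_degree_of_subset_roots (p := Polynomial.ofFn k (D - D'))
    fun t ht => ?_).trans ?_
  · rw [Finset.mem_val, Finset.mem_filter_univ] at ht
    rw [Polynomial.mem_roots ne_zero, map_sub, Polynomial.IsRoot, Polynomial.eval_sub]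
    exact sub_eq_zero.2 ht
  · exact Polynomial.natDegree_le_of_degree_le (Polynomial.ofFn_degree_lt _).le

/-- Distinct polynomials of degree less than `k` agree on at most half of the field. -/
theorem swapPromise_polynomialFunction (hk : 2 * k ≤ Fintype.card F) (D D' E : Fin k → F) :
    SwapPromise (shear (polynomialFunction E)) (functionGraph (polynomialFunction D))
      (functionGraph (polynomialFunction D')) (decide (D + E = D')) := by
  by_cases h : D + E = D'
  · rw [decide_eq_true h, ← h]
    exact swapPromise_shear_true (polynomialFunction_add D E).symm
  · rw [decide_eq_false h]
    refine swapPromise_shear_false ?_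
    simp only [← Pi.add_apply, ← polynomialFunction_add]
    have agreement := card_polynomialFunction_eq_le h
    omega

end PolynomialGraphs

section Sketches

variable {F : Type*} [Field F] {k : ℕ}

/-- The first `r` power sums `∑ w, D w * α w ^ j` of a vector with weights `D` at the points `α`:
a linear sketch that determines sparse vectors. -/
def sketch (α : Fin k → F) (r : ℕ) : (Fin k → F) →ₗ[F] (Fin r → F) :=
  Matrix.mulVecLin (Matrix.of fun j w => α w ^ (j : ℕ))

theorem sketch_apply (α : Fin k → F) (r : ℕ) (D : Fin k → F) (j : Fin r) :
    sketch α r D j = ∑ w, D w * α w ^ (j : ℕ) := by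
  simp [sketch, Matrix.mulVec, dotProduct, mul_comm]

variable [DecidableEq F]

theorem eq_zero_of_sketch_eq_zero {α : Fin k → F} (hα : Function.Injective α) {r : ℕ}
    {D : Fin k → F} (hD : hammingNorm D ≤ r) (h : sketch α r D = 0) : D = 0 := by
  let e : Fin (hammingNorm D) ≃ {w // D w ≠ 0} :=
    Fintype.equivOfCardEq (by rw [Fintype.card_fin, Fintype.card_subtype]; rfl)
  have restricted : (fun i => D (e i)) = 0 := by
    refine Matrix.eq_zero_of_forall_pow_sum_mul_pow_eq_zero (f := fun i => α (e i))
      (hα.comp (Subtype.val_injective.comp e.injective)) fun j => ?_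
    rw [e.sum_comp fun w => D w * α w ^ (j : ℕ)]
    have power_sum := congrFun h (j.castLE hD)
    rw [sketch_apply] at power_sum
    rwa [← Finset.sum_subtype {w | D w ≠ 0} (by simp) fun w => D w * α w ^ (j : ℕ),
      Finset.sum_filter_of_ne fun w _ h => left_ne_zero_of_mul h]
  by_contra hne
  obtain ⟨w, hw⟩ := Function.ne_iff.1 hne
  exact hw (by simpa using congrFun restricted (e.symm ⟨w, hw⟩))

theorem injOn_sketch {α : Fin k → F} (hα : Function.Injective α) {s r : ℕ} (hr : 2 * s ≤ r) :
    Set.InjOn (sketch α r) {D | hammingNorm D ≤ s} := by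
  intro D hD D' hD' h
  refine sub_eq_zero.1 (eq_zero_of_sketch_eq_zero hα (r := r) ?_ (by rw [map_sub, h, sub_self]))
  rw [← neg_add_eq_sub, ← hammingDist_eq_hammingNorm]
  have triangle := hammingDist_triangle D' 0 D
  rw [hammingDist_zero_right, hammingDist_zero_left] at triangle
  have sparse : hammingNorm D ≤ s := hD
  have sparse' : hammingNorm D' ≤ s := hD'
  omega

/-- The vector with at most `s` nonzero coordinates and sketch `y`, if there is one. -/
noncomputable def sparseRecovery (α : Fin k → F) (s : ℕ) {r : ℕ} (y : Fin r → F) : Fin k → F :=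
  Function.invFunOn (sketch α r) {D | hammingNorm D ≤ s} y

theorem sparseRecovery_sketch {α : Fin k → F} (hα : Function.Injective α) {s r : ℕ}
    (hr : 2 * s ≤ r) {D : Fin k → F} (hD : hammingNorm D ≤ s) :
    sparseRecovery α s (sketch α r D) = D :=
  (injOn_sketch hα hr).leftInvOn_invFunOn hD

end Sketches

section FingerprintProtocols

variable {k L : ℕ} {X C : Type}

/-- The basis states in the support of a message: `L` elements of `A` and the classical string
`c`. -/
def messageSet (L : ℕ) (A : Finset X) (c : C) : Finset ((Fin L → X) × C) :=
  (Fintype.piFinset fun _ => A) ×ˢ {c}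

theorem mem_messageSet {A : Finset X} {c : C} {a : (Fin L → X) × C} :
    a ∈ messageSet L A c ↔ (∀ j, a.1 j ∈ A) ∧ a.2 = c := by
  rw [messageSet, Finset.mem_product, Fintype.mem_piFinset, Finset.mem_singleton]

theorem messageSet_nonempty {A : Finset X} (hA : A.Nonempty) (c : C) :
    (messageSet L A c).Nonempty :=
  (Fintype.piFinset_nonempty.2 fun _ => hA).product (Finset.singleton_nonempty c)

/-- The registers of all players, split into their quantum parts and their classical parts. -/
def splitRegisters (k L : ℕ) (X C : Type) :
    (Fin k → (Fin L → X) × C) ≃ (Fin L → Fin k → X) × (Fin k → C) :=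
  (Equiv.arrowProdEquivProdArrow _ _ _).trans ((Equiv.piComm _).prodCongr (Equiv.refl _))

variable [DecidableEq X]

theorem tensorVec_uniformState_messageSet [DecidableEq C] (A : Fin k → Finset X)
    (c : Fin k → C) :
    (tensorVec fun v => uniformState (messageSet L (A v) (c v))) =
      (fun a => if a.2 = c then fingerprintState L A a.1 else 0) ∘ splitRegisters k L X C := by
  have tagged (S : Finset (Fin L → Fin k → X)) :
      (fun a => if a.2 = c then uniformState S a.1 else 0) = uniformState (S ×ˢ {c}) := by
    ext a
    by_cases h : a.2 = c <;>
      simp [uniformState, Finset.mem_product, h, -Finset.product_singleton]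
  rw [fingerprintState, tensorVec_uniformState, tensorVec_uniformState, tagged]
  refine (uniformState_comp_equiv _ fun b => ?_).symm
  simp only [splitRegisters, Finset.mem_product, Fintype.mem_piFinset, mem_messageSet,
    Finset.mem_singleton, funext_iff, forall_and]
  rw [forall_comm]
  rfl

variable [Fintype X] [Fintype C] {n N : ℕ} {O : Type} [Fintype O]

/-- The protocol in which player `v`, on input `x`, sends `L` uniform superpositions of the set
`A v x` together with the classical string `c v x`, and the referee measures the superpositions by
a measurement that depends on the classical strings. -/
noncomputable def fingerprintProtocol [DecidableEq C] (e : (Fin N → Bool) ≃ (Fin L → X) × C)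
    {A : Fin k → (Fin n → Bool) → Finset X} (hA : ∀ v x, (A v x).Nonempty)
    (c : Fin k → (Fin n → Bool) → C) (M : (Fin k → C) → POVM (Fin L → Fin k → X) O) :
    QuantumSMP k n O where
  qubits _ := N
  message v x := WithLp.toLp 2 (uniformState (messageSet L (A v x) (c v x)) ∘ e)
  norm_message v x := by
    rw [norm_toLp_comp_equiv, norm_toLp_uniformState (messageSet_nonempty (hA v x) _)]
  referee := (POVM.controlled M).reindex <|
    (Equiv.piCongrRight fun _ => e).trans (splitRegisters k L X C)

theorem cost_fingerprintProtocol [DecidableEq C] (e : (Fin N → Bool) ≃ (Fin L → X) × C)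
    {A : Fin k → (Fin n → Bool) → Finset X} (hA : ∀ v x, (A v x).Nonempty)
    (c : Fin k → (Fin n → Bool) → C) (M : (Fin k → C) → POVM (Fin L → Fin k → X) O) :
    (fingerprintProtocol e hA c M).cost = k * N := by
  simp [QuantumSMP.cost, fingerprintProtocol]

theorem outputProb_fingerprintProtocol [DecidableEq C] (e : (Fin N → Bool) ≃ (Fin L → X) × C)
    {A : Fin k → (Fin n → Bool) → Finset X} (hA : ∀ v x, (A v x).Nonempty)
    (c : Fin k → (Fin n → Bool) → C) (M : (Fin k → C) → POVM (Fin L → Fin k → X) O)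
    (x : Fin k → Fin n → Bool) (o : O) :
    (fingerprintProtocol e hA c M).outputProb x o =
      (M fun v => c v (x v)).prob (fingerprintState L fun v => A v (x v)) o := by
  rw [← POVM.prob_controlled]
  refine Eq.trans ?_ (POVM.prob_reindex _ ((Equiv.piCongrRight fun _ => e).trans
    (splitRegisters k L X C)) _ _)
  rw [Equiv.coe_trans, ← Function.comp_assoc, ← tensorVec_uniformState_messageSet]
  rfl

/-- The tests may depend on the classical strings, which the referee reads without disturbing the
superpositions. -/
theorem exists_protocol_of_swapPromise {I : Type*} [Fintype I]
    (hN : 2 ^ N = Fintype.card ((Fin L → X) × C))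
    (hL : 64 * (Fintype.card I : ℝ) ^ 2 * (3 / 4) ^ L ≤ 1)
    {A : Fin k → (Fin n → Bool) → Finset X} (hA : ∀ v x, (A v x).Nonempty)
    (c : Fin k → (Fin n → Bool) → C) {u v : I → Fin k} (huv : ∀ i, u i ≠ v i)
    (e : (Fin k → C) → I → Equiv.Perm X) (g : (Fin k → C) → (I → Bool) → O) :
    ∃ P : QuantumSMP k n O, P.cost = k * N ∧ ∀ x b,
      (∀ i, SwapPromise (e (fun w => c w (x w)) i) (A (v i) (x (v i))) (A (u i) (x (u i))) (b i)) →
        2 / 3 ≤ P.outputProb x (g (fun w => c w (x w)) b) := by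
  classical
  let encoding : (Fin N → Bool) ≃ (Fin L → X) × C := Fintype.equivOfCardEq (by simpa using hN)
  let i := (Fintype.equivFin I).symm
  let M (y : Fin k → C) : POVM (Fin L → Fin k → X) O :=
    (POVM.swapTests L (u ∘ i) (v ∘ i) (e y ∘ i)).map fun b => g y (b ∘ i.symm)
  refine ⟨fingerprintProtocol encoding hA c M, cost_fingerprintProtocol _ _ _ _, fun x b h => ?_⟩
  rw [outputProb_fingerprintProtocol]
  have tests := POVM.two_thirds_le_prob_swapTests hL (u := u ∘ i) (v := v ∘ i) (e := e _ ∘ i)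
    (A := fun w => A w (x w)) (b := b ∘ i) (fun j => huv (i j)) (fun w => hA w (x w))
    fun j => h (i j)
  simpa only [M, Function.comp_assoc, Equiv.self_comp_symm, Function.comp_id] using tests.trans
    (POVM.prob_le_prob_map _ (fun b => g (fun w => c w (x w)) (b ∘ i.symm)) _ _)

end FingerprintProtocols

section Cliques

theorem ncard_neighborSet_sdiff_le_iff {V : Type*} {G : SimpleGraph V} {S : Finset V}
    (hS : G.IsClique S) {v : V} (hv : v ∈ S) (hfin : (G.neighborSet v).Finite) (d : ℕ) :
    (G.neighborSet v \ S).ncard ≤ d ↔ (G.neighborSet v).ncard + 1 ≤ d + S.card := by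
  classical
  have inside : G.neighborSet v ∩ S = S.erase v := by
    ext w
    simp only [Set.mem_inter_iff, SimpleGraph.mem_neighborSet, Finset.mem_coe, Finset.mem_erase]
    exact ⟨fun h => ⟨h.1.ne', h.2⟩, fun h => ⟨hS hv h.2 h.1.symm, h.2⟩⟩
  have split := Set.ncard_inter_add_ncard_sdiff_eq_ncard (G.neighborSet v) S hfin
  rw [inside, Set.ncard_coe_finset] at split
  have card_erase := Finset.card_erase_add_one hv
  omega

variable {k : ℕ}

open Classical in
theorem neighborhoodVector_eq_true_iff {G : SimpleGraph (Fin k)} {v w : Fin k} :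
    neighborhoodVector G v w = true ↔ G.Adj v w :=
  decide_eq_true_iff

theorem card_filter_neighborhoodVector (G : SimpleGraph (Fin k)) (v : Fin k) :
    ({w | neighborhoodVector G v w} : Finset (Fin k)).card = (G.neighborSet v).ncard := by
  rw [← Set.ncard_coe_finset]
  congr 1
  ext w
  simp [neighborhoodVector_eq_true_iff]

section ClosedNeighborhoods

variable {F : Type*} [Zero F] [One F]

variable (F) in
/-- The characteristic vector of the closed neighborhood of a node `v` with neighborhood vector
`x`. -/
def closedIndicator (v : Fin k) (x : Fin k → Bool) : Fin k → F :=
  fun w => if w = v ∨ x w then 1 else 0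

theorem closedIndicator_self (v : Fin k) (x : Fin k → Bool) :
    closedIndicator F v x v = 1 :=
  if_pos (Or.inl rfl)

variable {G : SimpleGraph (Fin k)}

theorem closedIndicator_eq_one_iff [NeZero (1 : F)] {v w : Fin k} (h : w ≠ v) :
    closedIndicator F v (neighborhoodVector G v) w = 1 ↔ G.Adj v w := by
  simp [closedIndicator, neighborhoodVector_eq_true_iff, h]

variable [DecidableEq F]

/-- Inside the clique both closed neighborhoods contain every node, so they differ only at the few
neighbors outside. -/
theorem hammingDist_closedIndicator_le {d : ℕ} {S : Finset (Fin k)}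
    (h : IsMaxIsolatedClique G d S) {u v : Fin k} (hu : u ∈ S) (hv : v ∈ S) :
    hammingDist (closedIndicator F u (neighborhoodVector G u))
      (closedIndicator F v (neighborhoodVector G v)) ≤ 2 * d := by
  have inside {u w : Fin k} (hu : u ∈ S) (hw : w ∈ S) : w = u ∨ G.Adj u w :=
    or_iff_not_imp_left.2 fun hne => h.1 hu hw (Ne.symm hne)
  have support : ({w | closedIndicator F u (neighborhoodVector G u) w ≠
      closedIndicator F v (neighborhoodVector G v) w} : Set (Fin k)) ⊆
      (G.neighborSet u \ S) ∪ (G.neighborSet v \ S) := by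
    intro w hw
    by_cases hwS : w ∈ S
    · simp [closedIndicator, neighborhoodVector_eq_true_iff, inside hu hwS, inside hv hwS] at hw
    · have hwu : w ≠ u := fun h => hwS (h ▸ hu)
      have hwv : w ≠ v := fun h => hwS (h ▸ hv)
      by_contra hout
      simp_all [closedIndicator, neighborhoodVector_eq_true_iff]
  calc hammingDist (closedIndicator F u (neighborhoodVector G u))
        (closedIndicator F v (neighborhoodVector G v))
      = ({w | closedIndicator F u (neighborhoodVector G u) w ≠
          closedIndicator F v (neighborhoodVector G v) w} : Set (Fin k)).ncard := by
        rw [hammingDist, ← Set.ncard_coe_finset, Finset.coe_filter_univ]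
    _ ≤ (G.neighborSet u \ S).ncard + (G.neighborSet v \ S).ncard :=
        (Set.ncard_le_ncard support (Set.toFinite _)).trans (Set.ncard_union_le _ _)
    _ ≤ 2 * d := by
        linarith [h.2 u hu, h.2 v hv]

end ClosedNeighborhoods

section Decoding

variable {F : Type*} [AddCommGroupWithOne F] [DecidableEq F]

/-- The sets that the referee outputs, given the degrees `deg`, candidates `D u v` for the
difference of the closed neighborhoods of `u` and `v`, and bits `b` that tell which candidates are
correct. A correct candidate vanishes at `u` exactly if `v` is adjacent to `u`. -/
def decodeCliques (d : ℕ) (deg : Fin k → ℕ) (D : Fin k → Fin k → Fin k → F)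
    (b : {e : Fin k × Fin k // e.1 ≠ e.2} → Bool) : Finset (Finset (Fin k)) :=
  {S | ∀ u ∈ S, deg u + 1 ≤ d + S.card ∧
    ∀ v ∈ S, ∀ h : u ≠ v, b ⟨(u, v), h⟩ = true ∧ D u v u = 0}

variable [NeZero (1 : F)] {G : SimpleGraph (Fin k)}

theorem isMaxIsolatedClique_iff_differences {d : ℕ} {D : Fin k → Fin k → Fin k → F}
    (hD : ∀ u v, hammingDist (closedIndicator F u (neighborhoodVector G u))
        (closedIndicator F v (neighborhoodVector G v)) ≤ 2 * d →
      D u v = closedIndicator F u (neighborhoodVector G u) -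
        closedIndicator F v (neighborhoodVector G v)) (S : Finset (Fin k)) :
    IsMaxIsolatedClique G d S ↔ ∀ u ∈ S, (G.neighborSet u).ncard + 1 ≤ d + S.card ∧
      ∀ v ∈ S, u ≠ v → closedIndicator F v (neighborhoodVector G v) + D u v =
        closedIndicator F u (neighborhoodVector G u) ∧ D u v u = 0 := by
  constructor
  · intro h u hu
    refine ⟨(ncard_neighborSet_sdiff_le_iff h.1 hu (Set.toFinite _) d).1 (h.2 u hu),
      fun v hv huv => ?_⟩
    rw [hD u v (hammingDist_closedIndicator_le h hu hv), add_sub_cancel, Pi.sub_apply,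
      closedIndicator_self, (closedIndicator_eq_one_iff huv).2 (h.1 hv hu huv.symm)]
    exact ⟨rfl, sub_self 1⟩
  · intro h
    have clique : G.IsClique (S : Set (Fin k)) := by
      intro u hu v hv huv
      obtain ⟨difference, unchanged⟩ := (h u hu).2 v hv huv
      have at_u := congrFun difference u
      rw [Pi.add_apply, unchanged, add_zero, closedIndicator_self] at at_u
      exact ((closedIndicator_eq_one_iff huv).1 at_u).symm
    exact ⟨clique, fun v hv =>
      (ncard_neighborSet_sdiff_le_iff clique hv (Set.toFinite _) d).2 (h v hv).1⟩

theorem decodeCliques_eq_maxIsolatedCliques {d : ℕ} {D : Fin k → Fin k → Fin k → F}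
    (hD : ∀ u v, hammingDist (closedIndicator F u (neighborhoodVector G u))
        (closedIndicator F v (neighborhoodVector G v)) ≤ 2 * d →
      D u v = closedIndicator F u (neighborhoodVector G u) -
        closedIndicator F v (neighborhoodVector G v)) :
    (decodeCliques d (fun v => (G.neighborSet v).ncard) D fun e =>
      decide (closedIndicator F e.1.2 (neighborhoodVector G e.1.2) + D e.1.1 e.1.2 =
        closedIndicator F e.1.1 (neighborhoodVector G e.1.1))) = maxIsolatedCliques d G := by
  ext S
  simp [decodeCliques, maxIsolatedCliques, isMaxIsolatedClique_iff_differences hD]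

end Decoding

end Cliques

section Protocol

variable {F : Type} [Field F] {k m d : ℕ}

/-- The classical part of the message of a node `v` with neighborhood vector `x`: the degree of `v`
and a sketch of its closed neighborhood. -/
def cliqueMessage (α : Fin k → F) (m d : ℕ) (v : Fin k) (x : Fin k → Bool) :
    Fin (2 ^ m) × (Fin (4 * d) → F) :=
  (Fin.ofNat _ ({w | x w} : Finset (Fin k)).card, sketch α _ (closedIndicator F v x))

theorem fst_cliqueMessage (α : Fin k → F) (hk : k < 2 ^ m) (G : SimpleGraph (Fin k)) (v : Fin k) :
    ((cliqueMessage α m d v (neighborhoodVector G v)).1 : ℕ) = (G.neighborSet v).ncard := by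
  rw [cliqueMessage, card_filter_neighborhoodVector, Fin.val_ofNat]
  refine Nat.mod_eq_of_lt (lt_of_le_of_lt ?_ hk)
  simpa using Set.ncard_le_card (G.neighborSet v)

/-- The candidate for the difference of two closed neighborhoods that is computed from the messages
`y` and `y'`; it is correct whenever the difference is sparse. -/
noncomputable def differenceCandidate [DecidableEq F] (α : Fin k → F)
    (y y' : Fin (2 ^ m) × (Fin (4 * d) → F)) : Fin k → F :=
  sparseRecovery α (2 * d) (y.2 - y'.2)

theorem differenceCandidate_cliqueMessage [DecidableEq F] {α : Fin k → F}
    (hα : Function.Injective α) {u v : Fin k} {x x' : Fin k → Bool}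
    (h : hammingDist (closedIndicator F u x) (closedIndicator F v x') ≤ 2 * d) :
    differenceCandidate α (cliqueMessage α m d u x) (cliqueMessage α m d v x') =
      closedIndicator F u x - closedIndicator F v x' := by
  rw [differenceCandidate, cliqueMessage, cliqueMessage, ← map_sub]
  refine sparseRecovery_sketch hα (by omega) ?_
  rwa [← neg_add_eq_sub, ← hammingDist_eq_hammingNorm, hammingDist_comm]

theorem exists_protocol_of_card_eq_two_pow [Fintype F] {L : ℕ} (hF : Fintype.card F = 2 ^ m)
    (hk : 2 * k ≤ 2 ^ m) (hL : 64 * ((k : ℝ) ^ 2) ^ 2 * (3 / 4) ^ L ≤ 1) (d : ℕ) :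
    ∃ P : QuantumSMP k k (Finset (Finset (Fin k))),
      P.cost = k * (m * (1 + 4 * d + 2 * L)) ∧ P.SolvesNIH (maxIsolatedCliques d) := by
  classical
  have k_lt : k < 2 ^ m := by
    have := Nat.two_pow_pos m
    omega
  obtain ⟨α⟩ : Nonempty (Fin k ↪ F) :=
    Function.Embedding.nonempty_of_card_le (by rw [Fintype.card_fin, hF]; exact k_lt.le)
  have card_pairs : (Fintype.card {e : Fin k × Fin k // e.1 ≠ e.2} : ℝ) ≤ (k : ℝ) ^ 2 := by
    have := Fintype.card_subtype_le fun e : Fin k × Fin k => e.1 ≠ e.2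
    rw [Fintype.card_prod, Fintype.card_fin, ← sq] at this
    exact_mod_cast this
  obtain ⟨P, cost_eq, correct⟩ := exists_protocol_of_swapPromise (L := L)
    (A := fun v x => functionGraph (polynomialFunction (closedIndicator F v x)))
    (N := m * (1 + 4 * d + 2 * L)) (by simp [hF]; ring) (le_trans (by gcongr) hL)
    (fun _ _ => functionGraph_nonempty _) (cliqueMessage α m d)
    (fun e : {e : Fin k × Fin k // e.1 ≠ e.2} => e.2)
    (fun y e => shear (polynomialFunction (differenceCandidate α (y e.1.1) (y e.1.2))))
    fun y => decodeCliques d (fun v => (y v).1) fun u v => differenceCandidate α (y u) (y v)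
  refine ⟨P, cost_eq, fun G => ?_⟩
  rw [← decodeCliques_eq_maxIsolatedCliques fun u v =>
    differenceCandidate_cliqueMessage (m := m) α.injective]
  simp only [← fst_cliqueMessage (m := m) (d := d) α k_lt G]
  exact correct _ _ fun e => swapPromise_polynomialFunction (hF ▸ hk) _ _ _

theorem QuantumSMP.norm_toLp_jointState {n : ℕ} {O : Type} [Fintype O] (P : QuantumSMP k n O)
    (x : Fin k → Fin n → Bool) : ‖WithLp.toLp 2 (P.jointState x)‖ = 1 := by
  rw [← pow_left_inj₀ (norm_nonneg _) zero_le_one two_ne_zero, EuclideanSpace.norm_sq_eq]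
  have expansion :=
    Finset.prod_univ_sum (fun _ => Finset.univ) fun v b => ‖P.message v (x v) b‖ ^ 2
  simp only [← EuclideanSpace.norm_sq_eq, P.norm_message, one_pow, Finset.prod_const_one,
    Fintype.piFinset_univ] at expansion
  simp only [QuantumSMP.jointState, norm_prod, ← Finset.prod_pow, ← expansion, one_pow]

theorem exists_protocol_of_subsingleton (hk : k ≤ 1) {O : Type} [Fintype O]
    (f : SimpleGraph (Fin k) → O) : ∃ P : QuantumSMP k k O, P.cost = 0 ∧ P.SolvesNIH f := by
  classical
  have : Subsingleton (Fin k) := Fin.subsingleton_iff_le_one.2 hk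
  let P : QuantumSMP k k O :=
    { qubits _ := 0
      message _ _ := EuclideanSpace.single default 1
      norm_message _ _ := by simp
      referee := POVM.const (f ⊥) }
  refine ⟨P, by simp [QuantumSMP.cost, P], fun G => ?_⟩
  rw [congrArg f (Subsingleton.elim G ⊥), QuantumSMP.outputProb, POVM.prob_const,
    P.norm_toLp_jointState]
  norm_num

end Protocol

section Parameters

theorem three_fourths_pow_le (m : ℕ) : (3 / 4 : ℝ) ^ (18 * m) ≤ ((2 ^ m) ^ 6)⁻¹ := by
  rw [← pow_mul, mul_comm m, pow_mul, pow_mul, ← inv_pow]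
  gcongr
  norm_num

theorem union_bound_le_one {k m : ℕ} (hk : 2 * k ≤ 2 ^ m) (hm : m ≠ 0) :
    64 * ((k : ℝ) ^ 2) ^ 2 * (3 / 4) ^ (18 * m) ≤ 1 := by
  have two_k_le : 2 * (k : ℝ) ≤ 2 ^ m := by exact_mod_cast hk
  have two_le : (2 : ℝ) ≤ 2 ^ m := le_self_pow₀ one_le_two hm
  calc 64 * ((k : ℝ) ^ 2) ^ 2 * (3 / 4) ^ (18 * m)
      = 2 ^ 2 * (2 * (k : ℝ)) ^ 4 * (3 / 4) ^ (18 * m) := by ring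
    _ ≤ (2 ^ m) ^ 2 * (2 ^ m) ^ 4 * ((2 ^ m) ^ 6)⁻¹ := by
        gcongr
        exact three_fourths_pow_le m
    _ = 1 := by
        rw [← pow_add]
        exact mul_inv_cancel₀ (by positivity)

theorem two_mul_le_two_pow_log_add_two (k : ℕ) : 2 * k ≤ 2 ^ (Nat.log 2 k + 2) := by
  have := Nat.lt_pow_succ_log_self one_lt_two k
  rw [pow_succ']
  omega

theorem one_le_logb_two {k : ℕ} (hk : 2 ≤ k) : 1 ≤ Real.logb 2 k := by
  rw [Real.le_logb_iff_rpow_le one_lt_two (by positivity), Real.rpow_one]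
  exact_mod_cast hk

theorem log_add_two_le_three_mul_logb {k : ℕ} (hk : 2 ≤ k) :
    ((Nat.log 2 k + 2 : ℕ) : ℝ) ≤ 3 * Real.logb 2 k := by
  have one_le := one_le_logb_two hk
  have log_le := Real.natLog_le_logb k 2
  push_cast at *
  linarith

theorem exists_protocol_of_two_mul_le_two_pow {k m : ℕ} (hk : 2 * k ≤ 2 ^ m) (hm : m ≠ 0) (d : ℕ) :
    ∃ P : QuantumSMP k k (Finset (Finset (Fin k))),
      P.cost = k * (m * (1 + 4 * d + 36 * m)) ∧ P.SolvesNIH (maxIsolatedCliques d) := by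
  have := Fintype.ofFinite (GaloisField 2 m)
  have card_field : Fintype.card (GaloisField 2 m) = 2 ^ m := by
    rw [← Nat.card_eq_fintype_card, GaloisField.card 2 _ hm]
  obtain ⟨P, cost_eq, correct⟩ :=
    exists_protocol_of_card_eq_two_pow card_field hk (union_bound_le_one hk hm) d
  exact ⟨P, by rw [cost_eq]; ring, correct⟩

theorem mul_logb_mul_add_logb_le {C : ℝ} (hC : 0 ≤ C) {d : ℕ} (hd : 1 ≤ d) (k : ℕ) :
    C * k * Real.logb 2 k * (d + Real.logb 2 k) ≤ 2 * C * k * d * (Real.logb 2 k) ^ 2 := by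
  rcases Nat.lt_or_ge k 2 with hk | hk
  · interval_cases k <;> simp
  have one_le := one_le_logb_two hk
  have one_le_d : (1 : ℝ) ≤ d := by exact_mod_cast hd
  have sum_le : d + Real.logb 2 k ≤ 2 * (d * Real.logb 2 k) := by nlinarith
  calc C * k * Real.logb 2 k * (d + Real.logb 2 k)
      ≤ C * k * Real.logb 2 k * (2 * (d * Real.logb 2 k)) := by gcongr
    _ = 2 * C * k * d * (Real.logb 2 k) ^ 2 := by ring

end Parameters

theorem mainTheorem4_general :
    ∃ C : ℝ, 0 < C ∧ ∀ k d : ℕ,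
      ∃ P : QuantumSMP k k (Finset (Finset (Fin k))),
        (P.cost : ℝ) ≤ C * k * Real.logb 2 k * (d + Real.logb 2 k) ∧
          P.SolvesNIH (maxIsolatedCliques d) := by
  refine ⟨327, by norm_num, fun k d => ?_⟩
  rcases Nat.lt_or_ge k 2 with hk | hk
  · obtain ⟨P, cost_eq, correct⟩ :=
      exists_protocol_of_subsingleton (Nat.le_of_lt_succ hk) (maxIsolatedCliques d)
    exact ⟨P, by rw [cost_eq]; interval_cases k <;> simp, correct⟩
  · obtain ⟨P, cost_eq, correct⟩ := exists_protocol_of_two_mul_le_two_pow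
      (two_mul_le_two_pow_log_add_two k) (Nat.succ_ne_zero _) d
    set m := Nat.log 2 k + 2
    set ℓ := Real.logb 2 k
    have one_le : 1 ≤ ℓ := one_le_logb_two hk
    have m_le : m ≤ 3 * ℓ := log_add_two_le_three_mul_logb hk
    refine ⟨P, ?_, correct⟩
    calc (P.cost : ℝ) = k * (m * (1 + 4 * d + 36 * m)) := by
          rw [cost_eq]
          push_cast
          rfl
      _ ≤ k * ((3 * ℓ) * (ℓ + 109 * d + 36 * (3 * ℓ))) := by
          gcongr
          norm_num
      _ = 327 * k * ℓ * (d + ℓ) := by ring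

theorem mainTheorem4 :
    ∃ C : ℝ, 0 < C ∧ ∀ k d : ℕ, 1 ≤ d →
      ∃ P : QuantumSMP k k (Finset (Finset (Fin k))),
        (P.cost : ℝ) ≤ C * k * d * (Real.logb 2 k) ^ 2 ∧
          P.SolvesNIH (maxIsolatedCliques d) := by
  obtain ⟨C, C_pos, general⟩ := mainTheorem4_general
  refine ⟨2 * C, by positivity, fun k d hd => ?_⟩
  obtain ⟨P, cost_le, correct⟩ := general k d
  exact ⟨P, cost_le.trans (mul_logb_mul_add_logb_le C_pos.le hd k), correct⟩
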